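/- Let $\lambda>0$. A function $f:(0,\infty)\to\mathbb R$ is called completely monotonic if it is $C^\infty$ and $(-1)^n f^{(n)}(x)\ge 0$ for all $n\ge 0$ and $x>0$. Let $\mathcal B_\lambda$ (the generalized Bernstein functions of order $\lambda$) be the set of all $C^\infty$-functions $g:(0,\infty)\to[0,\infty)$ such that $x\mapsto g'(x)\,x^{1-\lambda}$ is completely monotonic on $(0,\infty)$. Let $\mathcal S_\lambda$ (the generalized Stieltjes functions of order $\lambda$) be the set of all functions $f:(0,\infty)\to\mathbb R$ of the form $$f(x)=c+\int_{[0,\infty)}\frac{d\mu(t)}{(t+x)^{\lambda}},\qquad x>0,$$ where $c\ge 0$ and $\mu$ is a positive Borel measure on $[0,\infty)$ with $\int_{[0,\infty)}(1+t)^{-\lambda}\,d\mu(t)<\infty$. Then for every $g\in\mathcal B_\lambda$ and every $x>0$ the integral in $$\mathrm{XL}(g)(x)=x\int_0^\infty e^{-xt}g(t)\,dt$$ converges absolutely, the function $\mathrm{XL}(g)$ is $C^\infty$ on $(0,\infty)$, and the mapping $\mathrm{XL}$ is a bijection of $\mathcal B_\lambda$ onto $\mathcal S_\lambda$. -/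

import Mathlib

open Set MeasureTheory
open scoped ContDiff NNReal

namespace GenBernstein

/-- The open half-line `(0, ∞)` as a type: the domain of all functions considered. -/
abbrev PosHalfLine : Type := Ioi (0 : ℝ)

/-- Extension by zero of a function on `(0, ∞)` to the real line. It is only a device to speak
about derivatives at points of the open set `(0, ∞)` and integrals over `(0, ∞)`; no value off `(0, ∞)` ever matters. -/
noncomputable def ext (g : PosHalfLine → ℝ) : ℝ → ℝ :=
  Function.extend Subtype.val g 0

theorem ext_coe (g : PosHalfLine → ℝ) (x : PosHalfLine) : ext g (x : ℝ) = g x :=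
  Subtype.val_injective.extend_apply g 0 x

/-- `g : (0, ∞) → ℝ` is of class `C^∞`. -/
def Smooth (g : PosHalfLine → ℝ) : Prop :=
  ContDiffOn ℝ ∞ (ext g) (Ioi 0)

/-- The derivative `g'` of a function `g : (0, ∞) → ℝ`. -/
noncomputable def derivative (g : PosHalfLine → ℝ) : PosHalfLine → ℝ :=
  fun x => deriv (ext g) (x : ℝ)

/-- `f : (0, ∞) → ℝ` is completely monotonic: it is `C^∞` and
`(-1)^n f^{(n)}(x) ≥ 0` for all `n ≥ 0` and `x > 0`. -/
def CompletelyMonotonic (f : PosHalfLine → ℝ) : Prop :=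
  Smooth f ∧
    ∀ (n : ℕ) (x : PosHalfLine), 0 ≤ (-1 : ℝ) ^ n * iteratedDerivWithin n (ext f) (Ioi 0) (x : ℝ)

/-- The class `𝓑_λ` of generalized Bernstein functions of order `lam`: nonnegative `C^∞` functions
`g` on `(0, ∞)` such that `x ↦ g'(x) x^{1-λ}` is completely monotonic. -/
def genBernstein (lam : ℝ) : Set (PosHalfLine → ℝ) :=
  {g | (∀ x, 0 ≤ g x) ∧ Smooth g ∧
    CompletelyMonotonic fun x => derivative g x * (x : ℝ) ^ (1 - lam)}

/-- The class `𝓢_λ` of generalized Stieltjes functions of order `lam`: functions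
`f(x) = c + ∫_{[0,∞)} dμ(t) / (t + x)^λ` with `c ≥ 0` and a positive measure `μ` on `[0, ∞)`
satisfying `∫_{[0,∞)} dμ(t) / (1 + t)^λ < ∞`. -/
def genStieltjes (lam : ℝ) : Set (PosHalfLine → ℝ) :=
  {f | ∃ (c : ℝ) (μ : Measure ℝ≥0), 0 ≤ c ∧
    Integrable (fun t : ℝ≥0 => 1 / (1 + (t : ℝ)) ^ lam) μ ∧
    ∀ x : PosHalfLine, f x = c + ∫ t : ℝ≥0, 1 / ((t : ℝ) + (x : ℝ)) ^ lam ∂μ}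

/-- `XL(g)(x) = x ∫_0^∞ e^{-xt} g(t) dt` for `x > 0`; the integral is with respect to Lebesgue
measure on `(0, ∞)`. -/
noncomputable def XL (g : PosHalfLine → ℝ) : PosHalfLine → ℝ :=
  fun x => (x : ℝ) * ∫ t in Ioi (0 : ℝ), Real.exp (-((x : ℝ) * t)) * ext g t

end GenBernstein

open Filter Topology ProbabilityTheory

namespace GenBernstein

/-! By Bernstein's theorem, `g'(s) s^(1-λ)` is the Laplace transform of a measure `ν` on `[0, ∞)`.
As `g` is nonnegative and increasing, it has a limit `a ≥ 0` at `0`, so `g(x) = a + ∫_0^x s^(λ-1) ∫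
e^{-st} dν(t) ds` (`exists_eq_bernsteinFn`). Integrating by parts and then applying Tonelli with the
Gamma integral gives `XL g (x) = a + Γ(λ) ∫ (t+x)^(-λ) dν(t)` (`XL_bernsteinFn`). The same Tonelli
computation shows that integrability of `g'` at `0` forces the Stieltjes condition on `ν`. Every
step can be run backwards from a pair `(a, ν)`, whence surjectivity with `a = c` and `ν = μ / Γ(λ)`.

Injectivity and smoothness come from reading `XL g (x) / x` as the Laplace transform of the measure
`g(t) dt`: such a transform is smooth and determines the measure, hence the continuous density `g`.

Bernstein's theorem is derived from the Hausdorff moment problem. The samples `f(c + k/N)` are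
moments of a measure on `[0, 1]`; weak compactness yields one measure for all rational exponents,
and `u = e^{-t}` turns moments into a Laplace transform. Uniqueness of Laplace transforms then
removes the shift `c`. -/

/-! ### The Hausdorff moment problem -/

/-- The negated forward difference of a sequence. -/
def seqDiff (a : ℕ → ℝ) : ℕ → ℝ := fun k => a k - a (k + 1)

/-- Completely monotonic sequences. -/
def CompletelyMonotonicSeq (a : ℕ → ℝ) : Prop := ∀ n k, 0 ≤ seqDiff^[n] a k

theorem iterate_seqDiff_shift (a : ℕ → ℝ) (n : ℕ) :
    seqDiff^[n] (fun k => a (k + 1)) = fun k => seqDiff^[n] a (k + 1) := by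
  induction n with
  | zero => rfl
  | succ n ih => rw [Function.iterate_succ_apply', ih, Function.iterate_succ_apply']; rfl

theorem CompletelyMonotonicSeq.shift {a : ℕ → ℝ} (ha : CompletelyMonotonicSeq a) :
    CompletelyMonotonicSeq fun k => a (k + 1) := fun n k => by
  rw [iterate_seqDiff_shift]; exact ha n (k + 1)

/-- The `k`-th moment of the `n`-th discrete approximation to the solution of the moment problem
for `a`. -/
noncomputable def approxMoment (a : ℕ → ℝ) (n k : ℕ) : ℝ :=
  ∑ p ∈ Finset.HasAntidiagonal.antidiagonal n, (n.choose p.1 * seqDiff^[p.2] a p.1) * ((p.1 : ℝ) / n) ^ k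

/-- The weights have a total mass independent of `n`: Pascal's rule splits level `n + 1` into two
sums over level `n`, which recombine because a difference at `i` plus the value at `i + 1` is the
value at `i`. -/
theorem approxMoment_zero (a : ℕ → ℝ) (n : ℕ) : approxMoment a n 0 = a 0 := by
  induction n with
  | zero => simp [approxMoment]
  | succ n ih =>
    rw [← ih]
    simp only [approxMoment, pow_zero, mul_one]
    rw [Finset.sum_antidiagonal_choose_succ_mul (fun i j => seqDiff^[j] a i),
      ← Finset.sum_add_distrib]
    refine Finset.sum_congr rfl fun p hp => ?_
    have h : n.choose p.2 = n.choose p.1 := by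
      rw [← Finset.HasAntidiagonal.mem_antidiagonal.1 hp, Nat.choose_symm_add]
    rw [Function.iterate_succ_apply', h]
    simp only [seqDiff]
    ring

/-- The absorption identity `(n+1).choose (i+1) * (i+1) = (n+1) * n.choose i` consumes one factor of
the node, and the node `0` drops out. What remains is the approximation for the shifted sequence,
with nodes `(i+1)/(n+1)` in place of `i/n`. -/
theorem approxMoment_succ (a : ℕ → ℝ) (n k : ℕ) :
    approxMoment a (n + 1) (k + 1) = ∑ p ∈ Finset.HasAntidiagonal.antidiagonal n,
      (n.choose p.1 * seqDiff^[p.2] (fun k => a (k + 1)) p.1) *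
        (((p.1 : ℝ) + 1) / (n + 1)) ^ k := by
  rw [approxMoment, Finset.Nat.antidiagonal_succ]
  simp only [Finset.sum_cons, Finset.sum_map, Function.Embedding.prodMap, Prod.map,
    Function.Embedding.coeFn_mk, Function.Embedding.refl_apply, iterate_seqDiff_shift]
  simp only [Nat.cast_zero, zero_div, ne_eq, Nat.add_eq_zero_iff, one_ne_zero, and_false,
    not_false_eq_true, zero_pow, mul_zero, zero_add]
  refine Finset.sum_congr rfl fun p _ => ?_
  have h : ((n + 1).choose (p.1 + 1) : ℝ) * (p.1 + 1) = (n + 1) * n.choose p.1 := by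
    exact_mod_cast (Nat.add_one_mul_choose_eq n p.1).symm
  have hn : (n : ℝ) + 1 ≠ 0 := by positivity
  simp only [Nat.succ_eq_add_one, Nat.cast_add, Nat.cast_one]
  rw [pow_succ]
  field_simp
  linear_combination seqDiff^[p.2] a (p.1 + 1) * h

/-- Corresponding nodes differ by at most `1/(n+2)`, `k`-th powers on `[0, 1]` are `k`-Lipschitz,
and the weights sum to `a 1`. Starting at level `n + 2` keeps both denominators nonzero. -/
theorem abs_approxMoment_sub_le {a : ℕ → ℝ} (ha : CompletelyMonotonicSeq a) (n k : ℕ) :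
    |approxMoment a (n + 2) (k + 1) - approxMoment (fun k => a (k + 1)) (n + 1) k| ≤
      k * a 1 / (n + 2) := by
  rw [approxMoment_succ, approxMoment, ← Finset.sum_sub_distrib]
  have hmass : a 1 = approxMoment (fun k => a (k + 1)) (n + 1) 0 := by rw [approxMoment_zero]
  rw [hmass, approxMoment, Finset.mul_sum, Finset.sum_div]
  refine (Finset.abs_sum_le_sum_abs _ _).trans (Finset.sum_le_sum fun p hp => ?_)
  have hw : 0 ≤ ((n + 1).choose p.1 : ℝ) * seqDiff^[p.2] (fun k => a (k + 1)) p.1 :=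
    mul_nonneg (by positivity) (ha.shift _ _)
  have hp1 : (p.1 : ℝ) ≤ n + 1 := by
    have := Finset.HasAntidiagonal.mem_antidiagonal.1 hp
    exact_mod_cast (by omega : p.1 ≤ n + 1)
  rw [← mul_sub, abs_mul, abs_of_nonneg hw, pow_zero, mul_one, mul_comm (k : ℝ), mul_div_assoc]
  refine mul_le_mul_of_nonneg_left ?_ hw
  push_cast
  set x : ℝ := ((p.1 : ℝ) + 1) / (n + 1 + 1)
  set y : ℝ := (p.1 : ℝ) / (n + 1)
  have hx : |x| ≤ 1 := by
    rw [abs_of_nonneg (by positivity)]; exact (div_le_one (by positivity)).2 (by linarith)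
  have hy : |y| ≤ 1 := by
    rw [abs_of_nonneg (by positivity)]; exact (div_le_one (by positivity)).2 (by linarith)
  have hxy : |x - y| ≤ 1 / (n + 2) := by
    have e : x - y = (1 / (n + 2)) * (1 - y) := by
      simp only [x, y]
      field_simp
      ring
    have hy0 : 0 ≤ y := by positivity
    rw [e, abs_mul, abs_of_nonneg (by positivity : (0 : ℝ) ≤ 1 / (n + 2))]
    refine mul_le_of_le_one_right (by positivity) ?_
    rw [abs_of_nonneg (by linarith [le_abs_self y])]
    linarith
  have hpow := abs_pow_sub_pow_le x y k
  have hmax : max |x| |y| ^ (k - 1) ≤ 1 := pow_le_one₀ (by positivity) (max_le hx hy)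
  calc |x ^ k - y ^ k| ≤ |x - y| * k * max |x| |y| ^ (k - 1) := hpow
    _ ≤ |x - y| * k * 1 := by gcongr
    _ ≤ 1 / (n + 2) * k * 1 := by gcongr
    _ = k / (n + 2) := by ring

theorem tendsto_approxMoment {a : ℕ → ℝ} (ha : CompletelyMonotonicSeq a) (k : ℕ) :
    Tendsto (fun n => approxMoment a n k) atTop (𝓝 (a k)) := by
  induction k generalizing a with
  | zero => simp [approxMoment_zero]
  | succ k ih =>
    rw [← tendsto_add_atTop_iff_nat 2]
    have h1 := (tendsto_add_atTop_iff_nat 1).2 (ih ha.shift)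
    have h2 : Tendsto (fun n : ℕ => approxMoment a (n + 2) (k + 1) -
        approxMoment (fun k => a (k + 1)) (n + 1) k) atTop (𝓝 0) := by
      refine squeeze_zero_norm (fun n => abs_approxMoment_sub_le ha n k) ?_
      exact tendsto_const_nhds.div_atTop
        (tendsto_atTop_add_const_right _ _ tendsto_natCast_atTop_atTop)
    simpa using h2.add h1

/-- The discrete measures on the unit interval approximating the solution of the moment problem. -/
noncomputable def approxMeasure (a : ℕ → ℝ) (n : ℕ) : Measure unitInterval :=
  ∑ p ∈ Finset.HasAntidiagonal.antidiagonal n, ENNReal.ofReal (n.choose p.1 * seqDiff^[p.2] a p.1) •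
    Measure.dirac (projIcc 0 1 zero_le_one ((p.1 : ℝ) / n))

instance (a : ℕ → ℝ) (n : ℕ) : IsFiniteMeasure (approxMeasure a n) := by
  refine ⟨?_⟩
  simp only [approxMeasure, Measure.coe_finsetSum, Measure.coe_smul, Finset.sum_apply,
    Pi.smul_apply, measure_univ, smul_eq_mul, mul_one]
  exact ENNReal.sum_lt_top.2 fun p _ => ENNReal.ofReal_lt_top

theorem integral_pow_approxMeasure {a : ℕ → ℝ} (ha : CompletelyMonotonicSeq a) (n k : ℕ) :
    ∫ u : unitInterval, (u : ℝ) ^ k ∂(approxMeasure a n) = approxMoment a n k := by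
  rw [approxMeasure, integral_finsetSum_measure, approxMoment]
  · refine Finset.sum_congr rfl fun p hp => ?_
    have hp1 : (p.1 : ℝ) ≤ n := by
      have := Finset.HasAntidiagonal.mem_antidiagonal.1 hp
      exact_mod_cast (by omega : p.1 ≤ n)
    rw [integral_smul_measure, integral_dirac, ENNReal.toReal_ofReal
      (mul_nonneg (by positivity) (ha _ _)), smul_eq_mul, projIcc_of_mem]
    exact ⟨by positivity, div_le_one_of_le₀ hp1 (by positivity)⟩
  · intro p _
    refine Integrable.smul_measure ?_ ENNReal.ofReal_ne_top
    exact (integrable_dirac (by simp))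

/-- A family of finite measures on the unit interval, all of the same mass, converges along some
ultrafilter finer than any given filter. -/
theorem exists_ultrafilter_tendsto_integral {m : ℕ → Measure unitInterval}
    [∀ n, IsFiniteMeasure (m n)] {C : ℝ}
    (hm : ∀ n, (m n).real univ = C) :
    ∃ (F : Ultrafilter ℕ) (μ : Measure unitInterval), IsFiniteMeasure μ ∧
      (F : Filter ℕ) ≤ atTop ∧
      ∀ φ : unitInterval → ℝ, Continuous φ →
        Tendsto (fun n => ∫ u, φ u ∂(m n)) F (𝓝 (∫ u, φ u ∂μ)) := by
  have hC : 0 ≤ C := hm 0 ▸ measureReal_nonneg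
  let M : ℕ → FiniteMeasure unitInterval := fun n => ⟨m n, inferInstance⟩
  let F : Ultrafilter ℕ := Ultrafilter.of atTop
  have hF : (F : Filter ℕ) ≤ atTop := Ultrafilter.of_le _
  have hmem : ((F.map M : Ultrafilter _) : Filter (FiniteMeasure unitInterval)) ≤
      𝓟 {μ | μ.mass = ⟨C, hC⟩} := by
    rw [le_principal_iff]
    refine Filter.mem_map.2 (Filter.univ_mem' fun n => ?_)
    exact NNReal.eq (hm n)
  -- On a compact space the finite measures of a fixed mass are weakly compact.
  obtain ⟨μ, -, hμ⟩ := (isCompact_setOfPred_finiteMeasure_eq_of_compactSpace unitInterval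
    ⟨C, hC⟩).ultrafilter_le_nhds _ hmem
  refine ⟨F, μ, inferInstance, hF, fun φ hφ => ?_⟩
  have ht : Tendsto M F (𝓝 μ) := hμ
  exact FiniteMeasure.tendsto_iff_forall_integral_tendsto.1 ht
    (BoundedContinuousFunction.mkOfCompact ⟨φ, hφ⟩)

/-- The Hausdorff moment problem: a completely monotonic sequence is the sequence of moments of a
finite measure on `[0, 1]`. -/
theorem exists_measure_moments {a : ℕ → ℝ} (ha : CompletelyMonotonicSeq a) :
    ∃ μ : Measure unitInterval, IsFiniteMeasure μ ∧
      ∀ k : ℕ, ∫ u : unitInterval, (u : ℝ) ^ k ∂μ = a k := by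
  have hmass : ∀ n, (approxMeasure a n).real univ = a 0 := fun n => by
    have := integral_pow_approxMeasure ha n 0
    simpa [approxMoment_zero] using this
  obtain ⟨F, μ, hμ, hF, h⟩ := exists_ultrafilter_tendsto_integral hmass
  refine ⟨μ, hμ, fun k => ?_⟩
  have h1 := h (fun u => (u : ℝ) ^ k) (by fun_prop)
  simp only [integral_pow_approxMeasure ha] at h1
  exact tendsto_nhds_unique h1 ((tendsto_approxMoment ha k).mono_left hF)

/-! ### Laplace transforms of measures on `[0, ∞)` -/

/-- The Laplace transform of a measure on `[0, ∞)`. -/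
noncomputable def laplace (ν : Measure ℝ≥0) (x : ℝ) : ℝ := ∫ t : ℝ≥0, Real.exp (-(x * t)) ∂ν

/-- The Laplace transform of `ν` converges at `x`. -/
def LaplaceIntegrable (ν : Measure ℝ≥0) (x : ℝ) : Prop :=
  Integrable (fun t : ℝ≥0 => Real.exp (-(x * t))) ν

theorem LaplaceIntegrable.mono {ν : Measure ℝ≥0} {x y : ℝ} (h : LaplaceIntegrable ν x)
    (hxy : x ≤ y) : LaplaceIntegrable ν y := by
  refine Integrable.mono' h (by fun_prop) (Eventually.of_forall fun t => ?_)
  rw [Real.norm_eq_abs, Real.abs_exp, Real.exp_le_exp, neg_le_neg_iff]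
  exact mul_le_mul_of_nonneg_right hxy t.2

theorem laplaceIntegrable_zero (ν : Measure ℝ≥0) [IsFiniteMeasure ν] : LaplaceIntegrable ν 0 := by
  simp [LaplaceIntegrable]

/-- Analyticity and the formulas for the derivatives are inherited from moment generating functions.
-/
theorem laplace_eq_mgf (ν : Measure ℝ≥0) : laplace ν = mgf (fun t : ℝ≥0 => -(t : ℝ)) ν := by
  ext x; simp [laplace, mgf]

theorem Ioi_subset_interior_integrableExpSet {ν : Measure ℝ≥0}
    (h : ∀ x, 0 < x → LaplaceIntegrable ν x) :
    Ioi 0 ⊆ interior (integrableExpSet (fun t : ℝ≥0 => -(t : ℝ)) ν) := by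
  refine interior_maximal (fun x hx => ?_) isOpen_Ioi
  simpa [integrableExpSet, LaplaceIntegrable] using h x hx

/-- A function on the line that is completely monotonic on `(0, ∞)`. -/
def IsCM (f : ℝ → ℝ) : Prop :=
  ContDiffOn ℝ ∞ f (Ioi 0) ∧ ∀ (n : ℕ) (x : ℝ), 0 < x → 0 ≤ (-1) ^ n * iteratedDeriv n f x

theorem contDiffOn_laplace {ν : Measure ℝ≥0} (h : ∀ x, 0 < x → LaplaceIntegrable ν x) :
    ContDiffOn ℝ ∞ (laplace ν) (Ioi 0) := by
  rw [laplace_eq_mgf]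
  exact (analyticOn_mgf.mono (Ioi_subset_interior_integrableExpSet h)).contDiffOn
    isOpen_Ioi.uniqueDiffOn

theorem isCM_laplace {ν : Measure ℝ≥0} (h : ∀ x, 0 < x → LaplaceIntegrable ν x) :
    IsCM (laplace ν) := by
  refine ⟨contDiffOn_laplace h, fun n x hx => ?_⟩
  rw [laplace_eq_mgf, iteratedDeriv_mgf (Ioi_subset_interior_integrableExpSet h hx),
    ← integral_const_mul]
  refine integral_nonneg fun t => ?_
  have e : (-1 : ℝ) ^ n * ((-(t : ℝ)) ^ n * Real.exp (x * -(t : ℝ))) =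
      (t : ℝ) ^ n * Real.exp (x * -(t : ℝ)) := by
    rw [← mul_assoc, ← mul_pow]; simp
  simp only [Pi.zero_apply, e]
  positivity

/-! #### Uniqueness -/

/-- The function `t ↦ e^{-t}` on `[0, ∞)`. -/
noncomputable def expNeg : BoundedContinuousFunction ℝ≥0 ℝ :=
  BoundedContinuousFunction.ofNormedAddCommGroup (fun t : ℝ≥0 => Real.exp (-(t : ℝ)))
    (by fun_prop) 1 fun t => by simp

/-- Polynomials in `e^{-t}` form an algebra separating points, and their integrals are combinations
of the values of the transform at natural numbers. -/
theorem ext_of_laplace_natCast {μ ν : Measure ℝ≥0} [IsFiniteMeasure μ] [IsFiniteMeasure ν]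
    (h : ∀ k : ℕ, laplace μ k = laplace ν k) : μ = ν := by
  let A : StarSubalgebra ℝ (BoundedContinuousFunction ℝ≥0 ℝ) :=
    { (Polynomial.aeval (R := ℝ) expNeg).range with
      star_mem' := fun {a} ha => by
        have : star a = a := by ext t; simp
        rwa [this] }
  have hA : ∀ g ∈ A, ∃ p : Polynomial ℝ, Polynomial.aeval expNeg p = g := fun g hg => hg
  refine ext_of_forall_mem_subalgebra_integral_eq_of_polish (𝕜 := ℝ) (A := A) ?_ ?_
  · intro s t hst
    refine ⟨_, ⟨_, ⟨expNeg, ⟨Polynomial.X, by simp⟩, rfl⟩, rfl⟩, ?_⟩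
    change Real.exp _ ≠ Real.exp _
    simpa using hst
  · intro g hg
    obtain ⟨p, rfl⟩ := hA g hg
    have key : ∀ (ρ : Measure ℝ≥0) [IsFiniteMeasure ρ],
        ∫ t, (Polynomial.aeval expNeg p) t ∂ρ = ∑ i ∈ p.support, p.coeff i * laplace ρ i := by
      intro ρ _
      have e : ∀ t, (Polynomial.aeval expNeg p) t =
          ∑ i ∈ p.support, p.coeff i * Real.exp (-((i : ℝ) * (t : ℝ))) := by
        intro t
        rw [Polynomial.aeval_eq_sum_range' (Nat.lt_succ_self _), BoundedContinuousFunction.coe_sum,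
          Finset.sum_apply]
        rw [Finset.sum_subset (Polynomial.supp_subset_range_natDegree_succ)]
        · refine Finset.sum_congr rfl fun i _ => ?_
          simp only [BoundedContinuousFunction.coe_smul, BoundedContinuousFunction.pow_apply,
            smul_eq_mul]
          change _ * Real.exp (-(t : ℝ)) ^ i = _
          rw [← Real.exp_nat_mul, mul_neg]
        · intro i _ hi
          simp [Polynomial.notMem_support_iff.1 hi]
      simp only [e]
      rw [integral_finsetSum]
      · simp [laplace, integral_const_mul]
      · exact fun i _ => ((laplaceIntegrable_zero ρ).mono (Nat.cast_nonneg i)).const_mul _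
    rw [key, key]
    simp only [h]

/-- The measure `e^{-ct} ν(dt)`. -/
noncomputable def expTilt (c : ℝ) (ν : Measure ℝ≥0) : Measure ℝ≥0 :=
  ν.withDensity fun t => ENNReal.ofReal (Real.exp (-(c * t)))

theorem laplaceIntegrable_expTilt_iff {c x : ℝ} {ν : Measure ℝ≥0} :
    LaplaceIntegrable (expTilt c ν) x ↔ LaplaceIntegrable ν (c + x) := by
  rw [LaplaceIntegrable, expTilt, integrable_withDensity_iff_integrable_smul₀' (by fun_prop)
    (by simp), LaplaceIntegrable]
  simp only [ENNReal.toReal_ofReal (Real.exp_nonneg _), smul_eq_mul, ← Real.exp_add]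
  simp only [add_mul, neg_add]

theorem laplace_expTilt (c x : ℝ) (ν : Measure ℝ≥0) :
    laplace (expTilt c ν) x = laplace ν (c + x) := by
  rw [laplace, expTilt, integral_withDensity_eq_integral_toReal_smul (by fun_prop) (by simp),
    laplace]
  simp only [ENNReal.toReal_ofReal (Real.exp_nonneg _), smul_eq_mul, ← Real.exp_add]
  simp only [add_mul, neg_add]

theorem expTilt_neg_expTilt (c : ℝ) (ν : Measure ℝ≥0) : expTilt (-c) (expTilt c ν) = ν := by
  rw [expTilt, expTilt, ← withDensity_mul _ (by fun_prop) (by fun_prop)]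
  convert withDensity_one using 2
  ext t
  simp only [Pi.mul_apply, Pi.one_apply]
  rw [← ENNReal.ofReal_mul (Real.exp_nonneg _), ← Real.exp_add]
  simp

theorem isFiniteMeasure_expTilt {c : ℝ} {ν : Measure ℝ≥0} (h : LaplaceIntegrable ν c) :
    IsFiniteMeasure (expTilt c ν) :=
  isFiniteMeasure_withDensity_ofReal h.2

/-- A measure on `[0, ∞)` is determined by its Laplace transform near infinity. -/
theorem ext_of_laplace {μ ν : Measure ℝ≥0} (c : ℝ) (hμ : LaplaceIntegrable μ c)
    (hν : LaplaceIntegrable ν c) (h : ∀ x, c ≤ x → laplace μ x = laplace ν x) : μ = ν := by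
  -- Tilting by `c` makes both measures finite and moves the evaluation points to `c + k`.
  have := isFiniteMeasure_expTilt hμ
  have := isFiniteMeasure_expTilt hν
  rw [← expTilt_neg_expTilt c μ, ← expTilt_neg_expTilt c ν]
  congr 1
  refine ext_of_laplace_natCast fun k => ?_
  rw [laplace_expTilt, laplace_expTilt]
  exact h _ (by simp)

/-! ### Bernstein's theorem -/

theorem IsCM.contDiffAt {f : ℝ → ℝ} (hf : IsCM f) {x : ℝ} (hx : 0 < x) : ContDiffAt ℝ ∞ f x :=
  hf.1.contDiffAt (Ioi_mem_nhds hx)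

theorem IsCM.antitoneOn {f : ℝ → ℝ} (hf : IsCM f) (n : ℕ) :
    AntitoneOn (fun x => (-1) ^ n * iteratedDeriv n f x) (Ioi 0) := by
  have hd : DifferentiableOn ℝ (iteratedDeriv n f) (Ioi 0) :=
    (hf.1.differentiableOn_iteratedDerivWithin (m := n) (by exact_mod_cast WithTop.coe_lt_top _)
      isOpen_Ioi.uniqueDiffOn).congr fun x hx =>
        (iteratedDerivWithin_of_isOpen isOpen_Ioi hx).symm
  refine antitoneOn_of_deriv_nonpos (convex_Ioi 0) (hd.const_mul _).continuousOn
    (by rw [interior_Ioi]; exact hd.const_mul _) fun x hx => ?_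
  rw [interior_Ioi] at hx
  rw [deriv_const_mul _ ((hd x hx).differentiableAt (Ioi_mem_nhds hx)), ← iteratedDeriv_succ]
  have := hf.2 (n + 1) x hx
  rw [pow_succ] at this
  linarith

/-- Each `(-1)^n f^(n)` is decreasing, so differences stay completely monotonic; iterating this
makes the samples of `f` a completely monotonic sequence. -/
theorem IsCM.sub_shift {f : ℝ → ℝ} (hf : IsCM f) {h : ℝ} (hh : 0 ≤ h) :
    IsCM fun x => f x - f (x + h) := by
  have hs : ∀ x, 0 < x → ContDiffAt ℝ ∞ (fun x => f (x + h)) x := fun x hx =>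
    (hf.contDiffAt (by positivity : 0 < x + h)).comp x (by fun_prop)
  refine ⟨fun x hx => ((hf.contDiffAt hx).sub (hs x hx)).contDiffWithinAt, fun n x hx => ?_⟩
  have hn : (n : WithTop ℕ∞) ≤ ∞ := by exact_mod_cast le_top
  rw [iteratedDeriv_fun_sub ((hf.contDiffAt hx).of_le hn) ((hs x hx).of_le hn),
    iteratedDeriv_comp_add_const, mul_sub]
  exact sub_nonneg.2 (hf.antitoneOn n hx (by positivity : 0 < x + h) (by linarith))

theorem IsCM.completelyMonotonicSeq {f : ℝ → ℝ} (hf : IsCM f) {c h : ℝ} (hc : 0 < c) (hh : 0 ≤ h) :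
    CompletelyMonotonicSeq fun k => f (c + k * h) := by
  intro n
  induction n generalizing f with
  | zero => exact fun k => by simpa using hf.2 0 (c + k * h) (by positivity)
  | succ n ih =>
    intro k
    rw [Function.iterate_succ_apply]
    have e : (seqDiff fun k => f (c + k * h)) =
        fun k : ℕ => (fun x => f x - f (x + h)) (c + k * h) := by
      ext k
      simp only [seqDiff]
      push_cast
      ring_nf
    rw [e]
    exact ih (hf.sub_shift hh) k

/-- Pushing the Hausdorff measure forward by `u ↦ u ^ N` rescales the exponent `k` to `k / N`. The
mass `f c` does not depend on `N`, which makes the compactness argument available. -/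
theorem IsCM.exists_measure_mesh {f : ℝ → ℝ} (hf : IsCM f) {c : ℝ} (hc : 0 < c) {N : ℕ}
    (hN : 0 < N) :
    ∃ μ : Measure unitInterval, IsFiniteMeasure μ ∧ μ.real univ = f c ∧
      ∀ k : ℕ, ∫ u : unitInterval, (u : ℝ) ^ ((k : ℝ) / N) ∂μ = f (c + k / N) := by
  obtain ⟨μ, hμ, h⟩ := exists_measure_moments
    (hf.completelyMonotonicSeq hc (by positivity : (0 : ℝ) ≤ 1 / N))
  have hm : Measurable fun u : unitInterval => u ^ N := (continuous_pow N).measurable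
  refine ⟨μ.map fun u => u ^ N, inferInstance, ?_, fun k => ?_⟩
  · rw [map_measureReal_apply hm MeasurableSet.univ]
    simpa using h 0
  · rw [integral_map hm.aemeasurable
      (measurable_subtype_coe.pow_const _).aestronglyMeasurable]
    have := h k
    rw [mul_one_div] at this
    rw [← this]
    refine integral_congr_ae (Eventually.of_forall fun u => ?_)
    have hN' : (N : ℝ) ≠ 0 := by positivity
    change ((u : ℝ) ^ N) ^ ((k : ℝ) / N) = (u : ℝ) ^ k
    rw [← Real.rpow_natCast, ← Real.rpow_mul u.2.1, mul_div_cancel₀ _ hN', Real.rpow_natCast]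

/-- With mesh `1 / n!`, every positive rational is a mesh point for all large `n`, so the integrals
are eventually constant along the ultrafilter. -/
theorem IsCM.exists_measure_rat {f : ℝ → ℝ} (hf : IsCM f) {c : ℝ} (hc : 0 < c) :
    ∃ μ : Measure unitInterval, IsFiniteMeasure μ ∧
      ∀ q : ℚ, 0 < q → ∫ u : unitInterval, (u : ℝ) ^ (q : ℝ) ∂μ = f (c + q) := by
  choose m hm hmass hint using fun n : ℕ => hf.exists_measure_mesh hc n.factorial_pos
  obtain ⟨F, μ, hμ, hF, h⟩ := exists_ultrafilter_tendsto_integral hmass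
  refine ⟨μ, hμ, fun q hq => ?_⟩
  have hq' : (0 : ℝ) < q := by exact_mod_cast hq
  have h1 := h (fun u => (u : ℝ) ^ (q : ℝ))
    (continuous_subtype_val.rpow_const fun _ => Or.inr hq'.le)
  refine tendsto_nhds_unique h1 (Tendsto.congr' ?_ tendsto_const_nhds)
  refine (eventually_ge_atTop q.den).filter_mono hF |>.mono fun n hn => ?_
  obtain ⟨d, hd⟩ := Nat.dvd_factorial q.den_pos hn
  have hd0 : (d : ℝ) ≠ 0 := by
    rintro h0
    rw [Nat.cast_eq_zero] at h0
    exact n.factorial_ne_zero (by rw [hd, h0, mul_zero])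
  have e : (q : ℝ) = ((q.num.toNat * d : ℕ) : ℝ) / (n.factorial : ℕ) := by
    rw [hd]
    push_cast
    rw [mul_div_mul_right _ _ hd0]
    have : ((q.num.toNat : ℕ) : ℝ) = (q.num : ℝ) := by
      exact_mod_cast congrArg (Int.cast : ℤ → ℝ) (Int.toNat_of_nonneg (Rat.num_nonneg.2 hq.le))
    rw [this]
    exact Rat.cast_def q
  beta_reduce
  rw [e, hint n]

theorem IsCM.exists_measure_shift {f : ℝ → ℝ} (hf : IsCM f) {c : ℝ} (hc : 0 < c) :
    ∃ ν : Measure ℝ≥0, IsFiniteMeasure ν ∧ ∀ x, 0 < x → laplace ν x = f (c + x) := by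
  obtain ⟨μ, hμ, h⟩ := hf.exists_measure_rat hc
  have hm : Measurable fun u : unitInterval => (-Real.log u).toNNReal := by fun_prop
  have hs : MeasurableSet {u : unitInterval | 0 < (u : ℝ)} :=
    measurableSet_lt measurable_const measurable_subtype_coe
  -- Under `t = -log u` the point `u = 0` goes to infinity. Discarding its mass is harmless since `0
  -- ^ q = 0` for `q > 0`.
  let ν := (μ.restrict {u | 0 < (u : ℝ)}).map fun u : unitInterval => (-Real.log u).toNNReal
  have hν : IsFiniteMeasure ν := inferInstance
  have hq : ∀ q : ℚ, 0 < q → laplace ν q = f (c + q) := by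
    intro q hq
    have hq' : (0 : ℝ) < q := by exact_mod_cast hq
    rw [← h q hq, laplace, integral_map hm.aemeasurable (by fun_prop),
      ← integral_indicator hs]
    refine integral_congr_ae (Eventually.of_forall fun u => ?_)
    by_cases hu : 0 < (u : ℝ)
    · have hl : 0 ≤ -Real.log u := neg_nonneg.2 (Real.log_nonpos u.2.1 u.2.2)
      simp only [indicator, mem_ofPred_eq, hu, if_true, Real.coe_toNNReal _ hl]
      rw [Real.rpow_def_of_pos hu]
      ring_nf
    · have hu0 : u = 0 := Subtype.ext (le_antisymm (not_lt.1 hu) u.2.1)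
      simp [indicator, hu0, Real.zero_rpow hq'.ne']
  refine ⟨ν, hν, fun x hx => ?_⟩
  have hL : ContinuousOn (laplace ν) (Ioi 0) :=
    (contDiffOn_laplace fun x hx => (laplaceIntegrable_zero ν).mono hx.le).continuousOn
  have hR : ContinuousOn (fun x => f (c + x)) (Ioi 0) :=
    hf.1.continuousOn.comp (by fun_prop) fun x hx => add_pos hc hx
  refine EqOn.of_subset_closure (s := Ioi 0 ∩ range ((↑) : ℚ → ℝ)) (t := Ioi 0) ?_ hL hR
    inter_subset_left ?_ hx
  · rintro _ ⟨hq0, q, rfl⟩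
    exact hq q (by exact_mod_cast mem_Ioi.1 hq0)
  · exact (Rat.isDenseEmbedding_coe_real.dense.open_subset_closure_inter isOpen_Ioi)

/-- Bernstein's theorem: a completely monotonic function is the Laplace transform of a measure. -/
theorem IsCM.exists_laplace_eq {f : ℝ → ℝ} (hf : IsCM f) :
    ∃ ν : Measure ℝ≥0, ∀ x, 0 < x → LaplaceIntegrable ν x ∧ laplace ν x = f x := by
  choose! ν hν h using fun c (hc : 0 < c) => hf.exists_measure_shift (c := c) hc
  have hint : ∀ c, 0 < c → LaplaceIntegrable (expTilt (-c) (ν c)) c := fun c hc => by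
    have := hν c hc
    rw [laplaceIntegrable_expTilt_iff, neg_add_cancel]
    exact laplaceIntegrable_zero _
  have heq : ∀ c x, 0 < c → c < x → laplace (expTilt (-c) (ν c)) x = f x := fun c x hc hx => by
    rw [laplace_expTilt, h c hc _ (by linarith)]
    ring_nf
  refine ⟨expTilt (-1) (ν 1), fun x hx => ?_⟩
  have hx2 : 0 < x / 2 := by positivity
  -- The measures built from the shifts `1` and `x / 2` have the same transform near infinity, so
  -- they coincide; the second description converges at `x` even when `x < 1`.
  have e : expTilt (-1) (ν 1) = expTilt (-(x / 2)) (ν (x / 2)) := by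
    refine ext_of_laplace (1 + x) ((hint 1 one_pos).mono (by linarith))
      ((hint _ hx2).mono (by linarith)) fun y hy => ?_
    rw [heq 1 y one_pos (by linarith), heq _ y hx2 (by linarith)]
  rw [e]
  exact ⟨(hint _ hx2).mono (by linarith), heq _ x hx2 (by linarith)⟩

/-! ### Stieltjes transforms as iterated Laplace transforms -/

/-- `ν` has density `1 / f` with respect to the finite measure `f ν`. This supplies the s-finiteness
that Tonelli requires. -/
theorem sFinite_of_integrable_pos {α : Type*} [MeasurableSpace α] {ν : Measure α} {f : α → ℝ}
    (hf : Measurable f) (hpos : ∀ t, 0 < f t) (h : Integrable f ν) : SFinite ν := by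
  have := isFiniteMeasure_withDensity_ofReal h.2
  rw [← withDensity_inv_same (μ := ν) (f := fun t => ENNReal.ofReal (f t)) (by fun_prop)
    (Eventually.of_forall fun t => by simpa using hpos t) (by simp)]
  infer_instance

theorem measurable_stieltjesKernel (lam x : ℝ) :
    Measurable fun t : ℝ≥0 => 1 / ((t : ℝ) + x) ^ lam := by fun_prop

/-- Integrability of `(1 + t)^{-λ}`. -/
def StieltjesIntegrable (lam : ℝ) (ν : Measure ℝ≥0) : Prop :=
  Integrable (fun t : ℝ≥0 => 1 / (1 + (t : ℝ)) ^ lam) ν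

section

variable {lam : ℝ} {ν : Measure ℝ≥0}

theorem StieltjesIntegrable.integrable (hlam : 0 < lam) (h : StieltjesIntegrable lam ν) {x : ℝ}
    (hx : 0 < x) : Integrable (fun t : ℝ≥0 => 1 / ((t : ℝ) + x) ^ lam) ν := by
  -- The comparison is `t + x ≥ m (1 + t)`.
  set m := min 1 x
  have hm : 0 < m := lt_min one_pos hx
  refine Integrable.mono' (h.const_mul (1 / m ^ lam))
    (measurable_stieltjesKernel lam x).aestronglyMeasurable (Eventually.of_forall fun t => ?_)
  have ht : (0 : ℝ) ≤ t := t.2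
  rw [Real.norm_of_nonneg (by positivity), one_div_mul_one_div, ← Real.mul_rpow hm.le (by positivity)]
  refine one_div_le_one_div_of_le (by positivity)
    (Real.rpow_le_rpow (by positivity) ?_ hlam.le)
  nlinarith [min_le_left 1 x, min_le_right 1 x]

theorem StieltjesIntegrable.laplaceIntegrable (hlam : 0 < lam) (h : StieltjesIntegrable lam ν)
    {s : ℝ} (hs : 0 < s) : LaplaceIntegrable ν s := by
  refine Integrable.mono' (h.const_mul (Real.exp s * (lam / s) ^ lam)) (by fun_prop)
    (Eventually.of_forall fun t => ?_)
  have ht : (0 : ℝ) ≤ t := t.2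
  rw [Real.norm_of_nonneg (Real.exp_nonneg _)]
  -- This is `y ≤ e^y` at `y = s (1 + t) / λ`, raised to the power `λ`.
  have h1 : (s * (1 + t) / lam) ^ lam ≤ Real.exp (s * (1 + t)) := by
    calc (s * (1 + t) / lam) ^ lam ≤ Real.exp (s * (1 + t) / lam) ^ lam :=
          Real.rpow_le_rpow (by positivity)
            ((le_add_of_nonneg_right zero_le_one).trans (Real.add_one_le_exp _)) hlam.le
      _ = Real.exp (s * (1 + t)) := by
          rw [← Real.exp_mul, div_mul_cancel₀ _ hlam.ne']
  have e : s * (1 + t) / lam = (1 + t) / (lam / s) := by field_simp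
  rw [e, Real.div_rpow (by positivity) (by positivity), div_le_iff₀ (by positivity)] at h1
  rw [mul_one_div, le_div_iff₀ (by positivity)]
  calc Real.exp (-(s * t)) * (1 + t) ^ lam
      ≤ Real.exp (-(s * t)) * (Real.exp (s * (1 + t)) * (lam / s) ^ lam) := by gcongr
    _ = Real.exp s * (lam / s) ^ lam := by
        rw [← mul_assoc, ← Real.exp_add]; ring_nf

/-- The function `s^{λ-1} ∫ e^{-st} dν(t)`, the derivative of the generalized Bernstein functions
represented by `ν`. -/
noncomputable def bernsteinDensity (lam : ℝ) (ν : Measure ℝ≥0) (s : ℝ) : ℝ :=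
  s ^ (lam - 1) * laplace ν s

theorem laplace_nonneg (ν : Measure ℝ≥0) (s : ℝ) : 0 ≤ laplace ν s :=
  integral_nonneg fun _ => Real.exp_nonneg _

theorem bernsteinDensity_nonneg {s : ℝ} (hs : 0 < s) : 0 ≤ bernsteinDensity lam ν s :=
  mul_nonneg (Real.rpow_nonneg hs.le _) (laplace_nonneg ν s)

theorem contDiffOn_bernsteinDensity (h : ∀ s, 0 < s → LaplaceIntegrable ν s) :
    ContDiffOn ℝ ∞ (bernsteinDensity lam ν) (Ioi 0) :=
  (contDiffOn_id.rpow_const_of_ne fun _ hx => (mem_Ioi.1 hx).ne').mul (contDiffOn_laplace h)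

theorem continuousOn_bernsteinDensity (h : ∀ s, 0 < s → LaplaceIntegrable ν s) :
    ContinuousOn (bernsteinDensity lam ν) (Ioi 0) :=
  (contDiffOn_bernsteinDensity h).continuousOn

/-- Tonelli and the Gamma integral. The form with `∫⁻` presupposes no integrability of either side,
so it yields both the equivalence of integrability and the value. -/
theorem lintegral_bernsteinDensity_mul_exp (hlam : 0 < lam)
    (h : ∀ s, 0 < s → LaplaceIntegrable ν s) {x : ℝ} (hx : 0 < x) :
    ∫⁻ s in Ioi 0, ENNReal.ofReal (bernsteinDensity lam ν s * Real.exp (-(x * s))) =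
      ∫⁻ t : ℝ≥0, ENNReal.ofReal (Real.Gamma lam * (1 / ((t : ℝ) + x) ^ lam)) ∂ν := by
  have : SFinite ν := sFinite_of_integrable_pos (by fun_prop) (fun t => Real.exp_pos _)
    (h 1 one_pos)
  calc ∫⁻ s in Ioi 0, ENNReal.ofReal (bernsteinDensity lam ν s * Real.exp (-(x * s)))
      = ∫⁻ s in Ioi 0, ∫⁻ t : ℝ≥0,
          ENNReal.ofReal (s ^ (lam - 1) * Real.exp (-(((t : ℝ) + x) * s))) ∂ν := by
        refine setLIntegral_congr_fun measurableSet_Ioi fun s hs => ?_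
        have hs : 0 < s := hs
        have e : ∀ t : ℝ≥0, s ^ (lam - 1) * Real.exp (-(((t : ℝ) + x) * s)) =
            s ^ (lam - 1) * Real.exp (-(x * s)) * Real.exp (-(s * t)) := fun t => by
          rw [mul_assoc, ← Real.exp_add]; ring_nf
        simp only [e]
        rw [← ofReal_integral_eq_lintegral_ofReal ((h s hs).const_mul _)
          (Eventually.of_forall fun t => by simp only [Pi.zero_apply]; positivity),
          integral_const_mul]
        simp only [bernsteinDensity, laplace]
        ring_nf
    _ = ∫⁻ t : ℝ≥0, ∫⁻ s : ℝ in Ioi 0,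
          ENNReal.ofReal (s ^ (lam - 1) * Real.exp (-(((t : ℝ) + x) * s))) ∂volume ∂ν := by
        refine lintegral_lintegral_swap (Measurable.aemeasurable ?_)
        simp only [Function.uncurry_def]
        fun_prop
    _ = _ := by
        refine lintegral_congr fun t => ?_
        have ht : 0 < (t : ℝ) + x := by positivity
        have hi : IntegrableOn (fun s : ℝ => s ^ (lam - 1) * Real.exp (-(((t : ℝ) + x) * s)))
            (Ioi 0) := by
          have := integrableOn_rpow_mul_exp_neg_mul_rpow (s := lam - 1) (p := 1) (b := t + x)
            (by linarith) one_pos ht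
          simpa only [Real.rpow_one, neg_mul] using this
        rw [← ofReal_integral_eq_lintegral_ofReal hi ((ae_restrict_iff' measurableSet_Ioi).2
          (Eventually.of_forall fun s hs => by
            have : 0 < s := hs
            simp only [Pi.zero_apply]; positivity)),
          Real.integral_rpow_mul_exp_neg_mul_Ioi hlam ht,
          Real.div_rpow zero_le_one ht.le, Real.one_rpow, mul_comm]

theorem aestronglyMeasurable_bernsteinDensity_mul_exp (h : ∀ s, 0 < s → LaplaceIntegrable ν s)
    (x : ℝ) : AEStronglyMeasurable (fun s => bernsteinDensity lam ν s * Real.exp (-(x * s)))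
      (volume.restrict (Ioi 0)) :=
  ((continuousOn_bernsteinDensity h).mul (by fun_prop)).aestronglyMeasurable measurableSet_Ioi

theorem bernsteinDensity_mul_exp_nonneg_ae (x : ℝ) :
    0 ≤ᵐ[volume.restrict (Ioi 0)] fun s => bernsteinDensity lam ν s * Real.exp (-(x * s)) :=
  (ae_restrict_iff' measurableSet_Ioi).2 (Eventually.of_forall fun _ hs =>
    mul_nonneg (bernsteinDensity_nonneg hs) (Real.exp_nonneg _))

theorem integrable_bernsteinDensity_mul_exp_iff (hlam : 0 < lam)
    (h : ∀ s, 0 < s → LaplaceIntegrable ν s) {x : ℝ} (hx : 0 < x) :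
    IntegrableOn (fun s => bernsteinDensity lam ν s * Real.exp (-(x * s))) (Ioi 0) ↔
      Integrable (fun t : ℝ≥0 => 1 / ((t : ℝ) + x) ^ lam) ν := by
  have hG := Real.Gamma_pos_of_pos hlam
  rw [← integrable_const_mul_iff (isUnit_iff_ne_zero.2 hG.ne')
      (fun t : ℝ≥0 => 1 / ((t : ℝ) + x) ^ lam), IntegrableOn, Integrable, Integrable,
    hasFiniteIntegral_iff_ofReal (bernsteinDensity_mul_exp_nonneg_ae x),
    hasFiniteIntegral_iff_ofReal (Eventually.of_forall fun t => by
      simp only [Pi.zero_apply]; positivity), lintegral_bernsteinDensity_mul_exp hlam h hx]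
  have h1 := aestronglyMeasurable_bernsteinDensity_mul_exp (lam := lam) h x
  have h2 : AEStronglyMeasurable
      (fun t : ℝ≥0 => Real.Gamma lam * (1 / ((t : ℝ) + x) ^ lam)) ν :=
    ((measurable_stieltjesKernel lam x).const_mul _).aestronglyMeasurable
  simp only [h1, h2, true_and]

theorem integral_bernsteinDensity_mul_exp (hlam : 0 < lam)
    (h : ∀ s, 0 < s → LaplaceIntegrable ν s) {x : ℝ} (hx : 0 < x) :
    ∫ s in Ioi 0, bernsteinDensity lam ν s * Real.exp (-(x * s)) =
      Real.Gamma lam * ∫ t : ℝ≥0, 1 / ((t : ℝ) + x) ^ lam ∂ν := by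
  have hG := Real.Gamma_pos_of_pos hlam
  rw [integral_eq_lintegral_of_nonneg_ae (bernsteinDensity_mul_exp_nonneg_ae x)
    (aestronglyMeasurable_bernsteinDensity_mul_exp h x),
    lintegral_bernsteinDensity_mul_exp hlam h hx, ← integral_const_mul,
    integral_eq_lintegral_of_nonneg_ae (Eventually.of_forall fun t => by
      simp only [Pi.zero_apply]; positivity)
      ((measurable_stieltjesKernel lam x).const_mul _).aestronglyMeasurable]

theorem StieltjesIntegrable.integrableOn_mul_exp (hlam : 0 < lam) (h : StieltjesIntegrable lam ν)
    {x : ℝ} (hx : 0 < x) :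
    IntegrableOn (fun s => bernsteinDensity lam ν s * Real.exp (-(x * s))) (Ioi 0) :=
  (integrable_bernsteinDensity_mul_exp_iff hlam (fun _ hs => h.laplaceIntegrable hlam hs) hx).2
    (h.integrable hlam hx)

theorem StieltjesIntegrable.integrableOn_Ioc (hlam : 0 < lam) (h : StieltjesIntegrable lam ν)
    (x : ℝ) : IntegrableOn (bernsteinDensity lam ν) (Ioc 0 x) := by
  have hL := fun s hs => h.laplaceIntegrable hlam (s := s) hs
  refine Integrable.mono' (((h.integrableOn_mul_exp hlam one_pos).mono_set
    Ioc_subset_Ioi_self).const_mul (Real.exp x))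
    ((continuousOn_bernsteinDensity hL).mono Ioc_subset_Ioi_self |>.aestronglyMeasurable
      measurableSet_Ioc) ((ae_restrict_iff' measurableSet_Ioc).2 (Eventually.of_forall ?_))
  intro s hs
  have hp := bernsteinDensity_nonneg (lam := lam) (ν := ν) hs.1
  rw [Real.norm_of_nonneg hp, mul_left_comm, ← Real.exp_add]
  refine le_mul_of_one_le_right hp (Real.one_le_exp ?_)
  linarith [hs.2]

end

/-! ### Integral representation of generalized Bernstein functions -/

/-- The generalized Bernstein function `a + ∫_0^x s^{λ-1} ∫ e^{-st} dν(t) ds`. -/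
noncomputable def bernsteinFn (a lam : ℝ) (ν : Measure ℝ≥0) (x : ℝ) : ℝ :=
  a + ∫ s in (0 : ℝ)..x, bernsteinDensity lam ν s

section

variable {a lam : ℝ} {ν : Measure ℝ≥0}

theorem StieltjesIntegrable.intervalIntegrable (hlam : 0 < lam) (h : StieltjesIntegrable lam ν)
    {x : ℝ} (hx : 0 ≤ x) : IntervalIntegrable (bernsteinDensity lam ν) volume 0 x :=
  (intervalIntegrable_iff_integrableOn_Ioc_of_le hx).2 (h.integrableOn_Ioc hlam x)

theorem StieltjesIntegrable.hasDerivAt_bernsteinFn (hlam : 0 < lam)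
    (h : StieltjesIntegrable lam ν) (a : ℝ) {x : ℝ} (hx : 0 < x) :
    HasDerivAt (bernsteinFn a lam ν) (bernsteinDensity lam ν x) x := by
  have hc := continuousOn_bernsteinDensity (lam := lam)
    fun s hs => h.laplaceIntegrable hlam (s := s) hs
  exact (intervalIntegral.integral_hasDerivAt_right (h.intervalIntegrable hlam hx.le)
    (hc.stronglyMeasurableAtFilter isOpen_Ioi x hx)
    (hc.continuousAt (Ioi_mem_nhds hx))).const_add a

theorem StieltjesIntegrable.continuousWithinAt_bernsteinFn (hlam : 0 < lam)
    (h : StieltjesIntegrable lam ν) (a : ℝ) :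
    ContinuousWithinAt (bernsteinFn a lam ν) (Ici 0) 0 := by
  have h1 : ContinuousWithinAt (fun x => ∫ s in (0 : ℝ)..x, bernsteinDensity lam ν s)
      (Icc 0 1) 0 :=
    intervalIntegral.continuousWithinAt_primitive (by simp)
      (by simpa using h.intervalIntegrable hlam zero_le_one)
  exact continuousWithinAt_const.add (h1.mono_of_mem_nhdsWithin (Icc_mem_nhdsGE one_pos))

theorem StieltjesIntegrable.contDiffOn_bernsteinFn (hlam : 0 < lam)
    (h : StieltjesIntegrable lam ν) (a : ℝ) : ContDiffOn ℝ ∞ (bernsteinFn a lam ν) (Ioi 0) := by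
  refine (contDiffOn_infty_iff_deriv_of_isOpen isOpen_Ioi).2 ⟨fun x hx =>
    (h.hasDerivAt_bernsteinFn hlam a hx).differentiableAt.differentiableWithinAt, ?_⟩
  exact (contDiffOn_bernsteinDensity fun s hs => h.laplaceIntegrable hlam hs).congr
    fun x hx => (h.hasDerivAt_bernsteinFn hlam a hx).deriv

theorem bernsteinFn_nonneg (ha : 0 ≤ a) {x : ℝ} (hx : 0 ≤ x) : 0 ≤ bernsteinFn a lam ν x := by
  refine add_nonneg ha ?_
  rw [intervalIntegral.integral_of_le hx]
  exact setIntegral_nonneg measurableSet_Ioc fun s hs => bernsteinDensity_nonneg hs.1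

/-- Insert `1 ≤ e^{x(y-s)}` for `s ≤ y`. Since `x > 0` is arbitrary, the growth is slower than any
exponential; rate `x / 2` gives the domination used next. -/
theorem StieltjesIntegrable.bernsteinFn_le (hlam : 0 < lam) (h : StieltjesIntegrable lam ν)
    (ha : 0 ≤ a) {x y : ℝ} (hx : 0 < x) (hy : 0 ≤ y) :
    bernsteinFn a lam ν y ≤
      (a + ∫ s in Ioi 0, bernsteinDensity lam ν s * Real.exp (-(x * s))) * Real.exp (x * y) := by
  have hi := h.integrableOn_mul_exp hlam hx
  rw [bernsteinFn, add_mul, intervalIntegral.integral_of_le hy]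
  refine add_le_add (le_mul_of_one_le_right ha (Real.one_le_exp (by positivity))) ?_
  calc ∫ s in Ioc 0 y, bernsteinDensity lam ν s
      ≤ ∫ s in Ioc 0 y, bernsteinDensity lam ν s * Real.exp (-(x * s)) * Real.exp (x * y) := by
        refine setIntegral_mono_on (h.integrableOn_Ioc hlam y)
          ((hi.mono_set Ioc_subset_Ioi_self).mul_const _) measurableSet_Ioc fun s hs => ?_
        rw [mul_assoc, ← Real.exp_add]
        refine le_mul_of_one_le_right (bernsteinDensity_nonneg hs.1) (Real.one_le_exp ?_)
        nlinarith [hs.2]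
    _ = (∫ s in Ioc 0 y, bernsteinDensity lam ν s * Real.exp (-(x * s))) * Real.exp (x * y) :=
        integral_mul_const _ _
    _ ≤ _ := by
        refine mul_le_mul_of_nonneg_right ?_ (Real.exp_nonneg _)
        exact setIntegral_mono_set hi (bernsteinDensity_mul_exp_nonneg_ae x)
          Ioc_subset_Ioi_self.eventuallyLE

theorem StieltjesIntegrable.exp_mul_bernsteinFn_le (hlam : 0 < lam)
    (h : StieltjesIntegrable lam ν) (ha : 0 ≤ a) {x : ℝ} (hx : 0 < x) :
    ∃ C, ∀ y, 0 ≤ y → Real.exp (-(x * y)) * bernsteinFn a lam ν y ≤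
      C * Real.exp (-(x / 2) * y) := by
  refine ⟨a + ∫ s in Ioi 0, bernsteinDensity lam ν s * Real.exp (-(x / 2 * s)),
    fun y hy => (mul_le_mul_of_nonneg_left (h.bernsteinFn_le hlam ha (half_pos hx) hy)
    (Real.exp_nonneg _)).trans_eq ?_⟩
  rw [mul_left_comm, ← Real.exp_add]
  ring_nf

theorem StieltjesIntegrable.integrableOn_exp_mul_bernsteinFn (hlam : 0 < lam)
    (h : StieltjesIntegrable lam ν) (ha : 0 ≤ a) {x : ℝ} (hx : 0 < x) :
    IntegrableOn (fun t => Real.exp (-(x * t)) * bernsteinFn a lam ν t) (Ioi 0) := by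
  obtain ⟨C, hC⟩ := h.exp_mul_bernsteinFn_le hlam ha hx
  refine Integrable.mono' ((exp_neg_integrableOn_Ioi 0 (half_pos hx)).const_mul C)
    ((ContinuousOn.mul (by fun_prop)
      (h.contDiffOn_bernsteinFn hlam a).continuousOn).aestronglyMeasurable measurableSet_Ioi)
    ((ae_restrict_iff' measurableSet_Ioi).2 (Eventually.of_forall fun t ht => ?_))
  have ht : 0 < t := ht
  rw [Real.norm_of_nonneg (mul_nonneg (Real.exp_nonneg _) (bernsteinFn_nonneg ha ht.le))]
  exact hC t ht.le

theorem StieltjesIntegrable.mul_integral_exp_mul_bernsteinFn (hlam : 0 < lam)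
    (h : StieltjesIntegrable lam ν) (ha : 0 ≤ a) {x : ℝ} (hx : 0 < x) :
    x * ∫ t in Ioi 0, Real.exp (-(x * t)) * bernsteinFn a lam ν t =
      a + Real.Gamma lam * ∫ t : ℝ≥0, 1 / ((t : ℝ) + x) ^ lam ∂ν := by
  have hi1 := (h.integrableOn_exp_mul_bernsteinFn hlam ha hx).const_mul x
  have hi2 := h.integrableOn_mul_exp hlam hx
  -- Integration by parts: this primitive tends to `0` at infinity and equals `-a` at `0`.
  have hderiv : ∀ t ∈ Ioi (0 : ℝ),
      HasDerivAt (fun t => -(Real.exp (-(x * t)) * bernsteinFn a lam ν t))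
        (x * (Real.exp (-(x * t)) * bernsteinFn a lam ν t) -
          bernsteinDensity lam ν t * Real.exp (-(x * t))) t := fun t ht => by
    have he : HasDerivAt (fun t => Real.exp (-(x * t))) (Real.exp (-(x * t)) * -x) t := by
      simpa using (((hasDerivAt_id t).const_mul x).neg).exp
    refine ((he.mul (h.hasDerivAt_bernsteinFn hlam a ht)).neg).congr_deriv ?_
    ring
  have hlim : Tendsto (fun t => -(Real.exp (-(x * t)) * bernsteinFn a lam ν t)) atTop (𝓝 0) := by
    obtain ⟨C, hC⟩ := h.exp_mul_bernsteinFn_le hlam ha hx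
    rw [← neg_zero]
    refine Tendsto.neg ?_
    have hexp : Tendsto (fun t => C * Real.exp (-(x / 2) * t)) atTop (𝓝 0) := by
      rw [← mul_zero C]
      refine Tendsto.const_mul C (Real.tendsto_exp_atBot.comp ?_)
      exact tendsto_id.const_mul_atTop_of_neg (by linarith)
    refine tendsto_of_tendsto_of_tendsto_of_le_of_le' tendsto_const_nhds hexp ?_ ?_
    · filter_upwards [eventually_ge_atTop 0] with t ht
      exact mul_nonneg (Real.exp_nonneg _) (bernsteinFn_nonneg ha ht)
    · filter_upwards [eventually_ge_atTop 0] with t ht using hC t ht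
  have hcont : ContinuousWithinAt (fun t => -(Real.exp (-(x * t)) * bernsteinFn a lam ν t))
      (Ici 0) 0 :=
    (ContinuousWithinAt.mul (by fun_prop) (h.continuousWithinAt_bernsteinFn hlam a)).neg
  have key := integral_Ioi_of_hasDerivAt_of_tendsto hcont hderiv (hi1.sub hi2) hlim
  rw [integral_sub hi1 hi2, integral_const_mul, integral_bernsteinDensity_mul_exp hlam
    (fun s hs => h.laplaceIntegrable hlam hs) hx] at key
  simp only [bernsteinFn, mul_zero, neg_zero, Real.exp_zero, intervalIntegral.integral_same,
    add_zero, one_mul, sub_neg_eq_add, zero_add] at key ⊢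
  linarith

/-! ### Passing between functions on the half-line and functions on the line. -/

theorem ext_eq_of_coe {g : PosHalfLine → ℝ} {f : ℝ → ℝ} (h : ∀ x : PosHalfLine, g x = f x) :
    EqOn (ext g) f (Ioi 0) := fun x hx => by
  rw [← h ⟨x, hx⟩]; exact ext_coe g ⟨x, hx⟩

theorem deriv_ext_eq_of_coe {g : PosHalfLine → ℝ} {f : ℝ → ℝ} (h : ∀ x : PosHalfLine, g x = f x)
    {x : ℝ} (hx : 0 < x) : deriv (ext g) x = deriv f x :=
  ((ext_eq_of_coe h).eventuallyEq_of_mem (Ioi_mem_nhds hx)).deriv_eq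

theorem completelyMonotonic_of_isCM {g : PosHalfLine → ℝ} {f : ℝ → ℝ} (hf : IsCM f)
    (h : ∀ x : PosHalfLine, g x = f x) : CompletelyMonotonic g := by
  refine ⟨hf.1.congr (ext_eq_of_coe h), fun n x => ?_⟩
  rw [iteratedDerivWithin_congr (ext_eq_of_coe h) x.2,
    iteratedDerivWithin_of_isOpen isOpen_Ioi x.2]
  exact hf.2 n x x.2

theorem CompletelyMonotonic.isCM_ext {g : PosHalfLine → ℝ} (hg : CompletelyMonotonic g) :
    IsCM (ext g) :=
  ⟨hg.1, fun n x hx => by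
    rw [← iteratedDerivWithin_of_isOpen isOpen_Ioi hx]
    exact hg.2 n ⟨x, hx⟩⟩

theorem StieltjesIntegrable.bernsteinFn_mem (hlam : 0 < lam) (h : StieltjesIntegrable lam ν)
    (ha : 0 ≤ a) : (fun x : PosHalfLine => bernsteinFn a lam ν x) ∈ genBernstein lam := by
  refine ⟨fun x => bernsteinFn_nonneg ha (le_of_lt x.2),
    (h.contDiffOn_bernsteinFn hlam a).congr (ext_eq_of_coe fun _ => rfl),
    completelyMonotonic_of_isCM (isCM_laplace fun s hs => h.laplaceIntegrable hlam hs)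
      fun x => ?_⟩
  have hx : (0 : ℝ) < x := x.2
  rw [derivative, deriv_ext_eq_of_coe (fun _ => rfl) hx, (h.hasDerivAt_bernsteinFn hlam a hx).deriv,
    bernsteinDensity, mul_right_comm, ← Real.rpow_add hx]
  simp

/-- Beyond `1` the transform of `ν` is at most its value at `1`, so the Gamma integrand dominates;
only the behaviour near `0` has to be assumed. -/
theorem integrableOn_bernsteinDensity_mul_exp_of_integrableOn_Ioc (hlam : 0 < lam)
    (h : ∀ s, 0 < s → LaplaceIntegrable ν s)
    (hi : IntegrableOn (bernsteinDensity lam ν) (Ioc 0 1)) :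
    IntegrableOn (fun s => bernsteinDensity lam ν s * Real.exp (-(1 * s))) (Ioi 0) := by
  have hm := aestronglyMeasurable_bernsteinDensity_mul_exp (lam := lam) h 1
  rw [← Ioc_union_Ioi_eq_Ioi zero_le_one]
  refine IntegrableOn.union ?_ ?_
  · refine Integrable.mono hi (hm.mono_measure (Measure.restrict_mono Ioc_subset_Ioi_self le_rfl))
      ((ae_restrict_iff' measurableSet_Ioc).2 (Eventually.of_forall fun s hs => ?_))
    rw [norm_mul, Real.norm_eq_abs (Real.exp _), Real.abs_exp]
    exact mul_le_of_le_one_right (norm_nonneg _) (Real.exp_le_one_iff.2 (by linarith [hs.1]))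
  · have hsub : Ioi (1 : ℝ) ⊆ Ioi 0 := Ioi_subset_Ioi zero_le_one
    refine Integrable.mono' (((Real.GammaIntegral_convergent hlam).mono_set hsub).const_mul
      (laplace ν 1)) (hm.mono_measure (Measure.restrict_mono hsub le_rfl))
      ((ae_restrict_iff' measurableSet_Ioi).2 (Eventually.of_forall fun s hs => ?_))
    have hs : 1 < s := hs
    have hs0 : 0 < s := one_pos.trans hs
    have hle : laplace ν s ≤ laplace ν 1 := by
      simpa using (isCM_laplace h).antitoneOn 0 (mem_Ioi.2 one_pos) (mem_Ioi.2 hs0) hs.le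
    rw [Real.norm_of_nonneg (mul_nonneg (bernsteinDensity_nonneg hs0) (Real.exp_nonneg _)),
      bernsteinDensity, one_mul, mul_comm (s ^ (lam - 1)), mul_assoc, mul_comm (s ^ (lam - 1))]
    exact mul_le_mul_of_nonneg_right hle (by positivity)

end

/-- A nonnegative function with nonnegative derivative on `(0, ∞)` has a limit at `0` and is
recovered from this limit and its derivative. -/
theorem exists_eq_add_integral_of_hasDerivAt_nonneg {g p : ℝ → ℝ}
    (hg : ∀ x, 0 < x → HasDerivAt g (p x) x) (hp : ∀ x, 0 < x → 0 ≤ p x)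
    (h0 : ∀ x, 0 < x → 0 ≤ g x) :
    ∃ a, 0 ≤ a ∧ ∀ x, 0 < x → IntegrableOn p (Ioc 0 x) ∧ g x = a + ∫ s in (0 : ℝ)..x, p s := by
  have hmono : MonotoneOn g (Ioi 0) := by
    refine monotoneOn_of_deriv_nonneg (convex_Ioi 0)
      (fun x hx => (hg x hx).continuousAt.continuousWithinAt) ?_ ?_
    · rw [interior_Ioi]
      exact fun x hx => (hg x hx).differentiableAt.differentiableWithinAt
    · rw [interior_Ioi]
      exact fun x hx => (hg x hx).deriv ▸ hp x hx
  have hbdd : BddBelow (g '' Ioi 0) := ⟨0, by rintro _ ⟨x, hx, rfl⟩; exact h0 x hx⟩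
  have hlim := hmono.tendsto_nhdsGT hbdd
  set a := sInf (g '' Ioi 0)
  refine ⟨a, ge_of_tendsto hlim (eventually_nhdsWithin_of_forall h0), fun x hx => ?_⟩
  have heq : ∀ y, 0 < y → Function.update g 0 a =ᶠ[𝓝 y] g := fun y hy => by
    filter_upwards [Ioi_mem_nhds hy] with z hz
    exact Function.update_of_ne (ne_of_gt hz) _ _
  have hd : ∀ y ∈ Ioo 0 x, HasDerivAt (Function.update g 0 a) (p y) y := fun y hy =>
    (hg y hy.1).congr_of_eventuallyEq (heq y hy.1)
  have hc : ContinuousOn (Function.update g 0 a) (Icc 0 x) := by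
    intro y hy
    rcases hy.1.eq_or_lt with rfl | hy0
    · refine continuousWithinAt_update_same.2 (hlim.mono_left (nhdsWithin_mono _ ?_))
      exact fun z hz => lt_of_le_of_ne hz.1.1 (Ne.symm hz.2)
    · exact ((hg y hy0).continuousAt.congr (heq y hy0).symm).continuousWithinAt
  -- Continuity up to `0` and the sign of `p` make `p` integrable with no further assumption.
  have hi := intervalIntegral.integrableOn_deriv_of_nonneg hc hd fun y hy => hp y hy.1
  refine ⟨hi, ?_⟩
  rw [intervalIntegral.integral_eq_sub_of_hasDerivAt_of_le hx.le hc hd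
    ((intervalIntegrable_iff_integrableOn_Ioc_of_le hx.le).2 hi)]
  simp [Function.update_of_ne hx.ne']

/-- The integral representation of generalized Bernstein functions. -/
theorem exists_eq_bernsteinFn {lam : ℝ} (hlam : 0 < lam) {g : PosHalfLine → ℝ}
    (hg : g ∈ genBernstein lam) :
    ∃ (a : ℝ) (ν : Measure ℝ≥0), 0 ≤ a ∧ StieltjesIntegrable lam ν ∧
      ∀ x : PosHalfLine, g x = bernsteinFn a lam ν x := by
  obtain ⟨h0, hs, hcm⟩ := hg
  obtain ⟨ν, hν⟩ := hcm.isCM_ext.exists_laplace_eq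
  have hL : ∀ s, 0 < s → LaplaceIntegrable ν s := fun s hs => (hν s hs).1
  have hd : ∀ x, 0 < x → HasDerivAt (ext g) (bernsteinDensity lam ν x) x := fun x hx => by
    have e : bernsteinDensity lam ν x = deriv (ext g) x := by
      rw [bernsteinDensity, (hν x hx).2]
      rw [ext_coe (fun x : PosHalfLine => derivative g x * (x : ℝ) ^ (1 - lam)) ⟨x, hx⟩, derivative,
        mul_left_comm, ← Real.rpow_add hx]
      simp
    rw [e]
    exact ((hs.contDiffAt (Ioi_mem_nhds hx)).differentiableAt (by simp)).hasDerivAt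
  obtain ⟨a, ha, h⟩ := exists_eq_add_integral_of_hasDerivAt_nonneg hd
    (fun x hx => bernsteinDensity_nonneg hx) fun x hx => by
      rw [ext_coe g ⟨x, hx⟩]; exact h0 _
  refine ⟨a, ν, ha, ?_, fun x => by rw [← ext_coe g x]; exact (h x x.2).2⟩
  have := (integrable_bernsteinDensity_mul_exp_iff hlam hL one_pos).1
    (integrableOn_bernsteinDensity_mul_exp_of_integrableOn_Ioc hlam hL (h 1 one_pos).1)
  simpa only [StieltjesIntegrable, add_comm] using this

/-! ### The transform `XL` -/

theorem integrableOn_exp_mul_ext {lam : ℝ} (hlam : 0 < lam) {g : PosHalfLine → ℝ}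
    (hg : g ∈ genBernstein lam) {x : ℝ} (hx : 0 < x) :
    IntegrableOn (fun t => Real.exp (-(x * t)) * ext g t) (Ioi 0) := by
  obtain ⟨a, ν, ha, hν, h⟩ := exists_eq_bernsteinFn hlam hg
  refine (hν.integrableOn_exp_mul_bernsteinFn hlam ha hx).congr_fun (fun t ht => ?_)
    measurableSet_Ioi
  rw [ext_eq_of_coe h ht]

theorem XL_bernsteinFn {a lam : ℝ} (hlam : 0 < lam) (ha : 0 ≤ a) {ν : Measure ℝ≥0}
    (hν : StieltjesIntegrable lam ν) {g : PosHalfLine → ℝ}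
    (h : ∀ x : PosHalfLine, g x = bernsteinFn a lam ν x) (x : PosHalfLine) :
    XL g x = a + Real.Gamma lam * ∫ t : ℝ≥0, 1 / ((t : ℝ) + x) ^ lam ∂ν := by
  rw [XL, ← hν.mul_integral_exp_mul_bernsteinFn hlam ha x.2]
  congr 1
  refine setIntegral_congr_fun measurableSet_Ioi fun t ht => ?_
  simp only [ext_eq_of_coe h ht]

/-- The measure `g(t) dt` on `[0, ∞)`. -/
noncomputable def densityMeasure (g : ℝ → ℝ) : Measure ℝ≥0 :=
  ((volume.restrict (Ioi 0)).withDensity fun t => ENNReal.ofReal (g t)).map Real.toNNReal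

/-! ### Laplace transforms and uniqueness for continuous densities. -/

section

variable {g : ℝ → ℝ}

theorem laplaceIntegrable_densityMeasure_iff (hg : ContinuousOn g (Ioi 0))
    (h0 : ∀ t, 0 < t → 0 ≤ g t) {x : ℝ} :
    LaplaceIntegrable (densityMeasure g) x ↔
      IntegrableOn (fun t => Real.exp (-(x * t)) * g t) (Ioi 0) := by
  have hm : AEMeasurable g (volume.restrict (Ioi 0)) := hg.aemeasurable measurableSet_Ioi
  rw [LaplaceIntegrable, densityMeasure, integrable_map_measure (by fun_prop) (by fun_prop),
    integrable_withDensity_iff_integrable_smul₀' hm.ennreal_ofReal (by simp), ← IntegrableOn]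
  refine integrableOn_congr_fun (fun t ht => ?_) measurableSet_Ioi
  have ht : 0 < t := ht
  simp [h0 t ht, ht.le, mul_comm]

theorem laplace_densityMeasure (hg : ContinuousOn g (Ioi 0)) (h0 : ∀ t, 0 < t → 0 ≤ g t) (x : ℝ) :
    laplace (densityMeasure g) x = ∫ t in Ioi 0, Real.exp (-(x * t)) * g t := by
  have hm : AEMeasurable g (volume.restrict (Ioi 0)) := hg.aemeasurable measurableSet_Ioi
  rw [laplace, densityMeasure, integral_map (by fun_prop) (by fun_prop),
    integral_withDensity_eq_integral_toReal_smul₀ hm.ennreal_ofReal (by simp)]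
  refine setIntegral_congr_fun measurableSet_Ioi fun t ht => ?_
  have ht : 0 < t := ht
  simp [h0 t ht, ht.le, mul_comm]

theorem map_coe_densityMeasure (g : ℝ → ℝ) :
    (densityMeasure g).map ((↑) : ℝ≥0 → ℝ) =
      (volume.restrict (Ioi 0)).withDensity fun t => ENNReal.ofReal (g t) := by
  rw [densityMeasure, Measure.map_map (by fun_prop) (by fun_prop)]
  conv_rhs => rw [← Measure.map_id (μ := (volume.restrict (Ioi 0)).withDensity _)]
  refine Measure.map_congr ((withDensity_absolutelyContinuous _ _).ae_le ?_)
  refine (ae_restrict_iff' measurableSet_Ioi).2 (Eventually.of_forall fun t ht => ?_)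
  exact Real.coe_toNNReal t (le_of_lt ht)

/-- Equal measures have densities equal almost everywhere, and continuity upgrades this to every
point of the open half-line. -/
theorem eqOn_of_densityMeasure_eq {f : ℝ → ℝ} (hf : ContinuousOn f (Ioi 0))
    (hg : ContinuousOn g (Ioi 0)) (hf0 : ∀ t, 0 < t → 0 ≤ f t) (hg0 : ∀ t, 0 < t → 0 ≤ g t)
    (h : densityMeasure f = densityMeasure g) : EqOn f g (Ioi 0) := by
  have h1 := map_coe_densityMeasure f
  rw [h, map_coe_densityMeasure, withDensity_eq_iff_of_sigmaFinite
    (hg.aemeasurable measurableSet_Ioi).ennreal_ofReal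
    (hf.aemeasurable measurableSet_Ioi).ennreal_ofReal] at h1
  refine Measure.eqOn_open_of_ae_eq (μ := volume) ?_ isOpen_Ioi hf hg
  filter_upwards [h1, self_mem_ae_restrict measurableSet_Ioi] with t ht ht0
  exact ((ENNReal.ofReal_eq_ofReal_iff (hg0 t ht0) (hf0 t ht0)).1 ht).symm

end

section

variable {lam : ℝ} {g : PosHalfLine → ℝ}

theorem continuousOn_ext_of_mem (hg : g ∈ genBernstein lam) : ContinuousOn (ext g) (Ioi 0) :=
  hg.2.1.continuousOn

theorem ext_nonneg_of_mem (hg : g ∈ genBernstein lam) (t : ℝ) (ht : 0 < t) : 0 ≤ ext g t := by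
  rw [ext_coe g ⟨t, ht⟩]; exact hg.1 _

theorem laplaceIntegrable_of_mem (hlam : 0 < lam) (hg : g ∈ genBernstein lam) {x : ℝ}
    (hx : 0 < x) : LaplaceIntegrable (densityMeasure (ext g)) x :=
  (laplaceIntegrable_densityMeasure_iff (continuousOn_ext_of_mem hg) (ext_nonneg_of_mem hg)).2
    (integrableOn_exp_mul_ext hlam hg hx)

theorem XL_eq_mul_laplace (hg : g ∈ genBernstein lam) (x : PosHalfLine) :
    XL g x = x * laplace (densityMeasure (ext g)) x := by
  rw [XL, laplace_densityMeasure (continuousOn_ext_of_mem hg) (ext_nonneg_of_mem hg)]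

theorem smooth_XL (hlam : 0 < lam) (hg : g ∈ genBernstein lam) : Smooth (XL g) :=
  (contDiffOn_id.mul (contDiffOn_laplace fun _ hx => laplaceIntegrable_of_mem hlam hg hx)).congr
    (ext_eq_of_coe fun x => XL_eq_mul_laplace hg x)

theorem injOn_XL (hlam : 0 < lam) : InjOn XL (genBernstein lam) := by
  intro f hf g hg hfg
  have h : densityMeasure (ext f) = densityMeasure (ext g) := by
    refine ext_of_laplace 1 (laplaceIntegrable_of_mem hlam hf one_pos)
      (laplaceIntegrable_of_mem hlam hg one_pos) fun x hx => ?_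
    have hx0 : 0 < x := one_pos.trans_le hx
    have := congrFun hfg ⟨x, hx0⟩
    rw [XL_eq_mul_laplace hf, XL_eq_mul_laplace hg] at this
    exact mul_left_cancel₀ hx0.ne' this
  funext x
  rw [← ext_coe f, ← ext_coe g]
  exact eqOn_of_densityMeasure_eq (continuousOn_ext_of_mem hf) (continuousOn_ext_of_mem hg)
    (ext_nonneg_of_mem hf) (ext_nonneg_of_mem hg) h x.2

theorem mapsTo_XL (hlam : 0 < lam) : MapsTo XL (genBernstein lam) (genStieltjes lam) := by
  intro g hg
  obtain ⟨a, ν, ha, hν, h⟩ := exists_eq_bernsteinFn hlam hg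
  refine ⟨a, ENNReal.ofReal (Real.Gamma lam) • ν, ha, hν.smul_measure ENNReal.ofReal_ne_top,
    fun x => ?_⟩
  rw [XL_bernsteinFn hlam ha hν h, integral_smul_measure,
    ENNReal.toReal_ofReal (Real.Gamma_pos_of_pos hlam).le, smul_eq_mul]

theorem surjOn_XL (hlam : 0 < lam) : SurjOn XL (genBernstein lam) (genStieltjes lam) := by
  rintro f ⟨c, μ, hc, hμ, hf⟩
  have hG := Real.Gamma_pos_of_pos hlam
  -- The factor `1 / Γ(λ)` cancels the one produced by the Gamma integral.
  have hν : StieltjesIntegrable lam (ENNReal.ofReal (Real.Gamma lam)⁻¹ • μ) :=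
    Integrable.smul_measure hμ ENNReal.ofReal_ne_top
  refine ⟨_, hν.bernsteinFn_mem hlam hc, funext fun x => ?_⟩
  rw [XL_bernsteinFn hlam hc hν fun _ => rfl, hf, integral_smul_measure,
    ENNReal.toReal_ofReal (inv_pos.2 hG).le, smul_eq_mul, mul_inv_cancel_left₀ hG.ne']

end

end GenBernstein

theorem mainTheorem9 (lam : ℝ) (hlam : 0 < lam) :
    (∀ g ∈ GenBernstein.genBernstein lam,
      (∀ x : GenBernstein.PosHalfLine,
        MeasureTheory.IntegrableOn
          (fun t : ℝ => Real.exp (-((x : ℝ) * t)) * GenBernstein.ext g t) (Set.Ioi 0)) ∧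
      GenBernstein.Smooth (GenBernstein.XL g)) ∧
    Set.BijOn GenBernstein.XL
      (GenBernstein.genBernstein lam) (GenBernstein.genStieltjes lam) :=
  ⟨fun _ hg => ⟨fun x => GenBernstein.integrableOn_exp_mul_ext hlam hg x.2,
    GenBernstein.smooth_XL hlam hg⟩,
    GenBernstein.mapsTo_XL hlam, GenBernstein.injOn_XL hlam, GenBernstein.surjOn_XL hlam⟩
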